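/- **Theorem (channel coding theorem for channels with noisy feedback).** Let $\mathcal X\neq\emptyset,\mathcal Y,\mathcal Z$ be finite alphabets, $\{p(y_i\mid x^i,y^{i-1})\}_{i\ge1}$ an arbitrary channel and $\{p(z_i\mid y^i,z^{i-1})\}_{i\ge1}$ an arbitrary feedback link; $\log$ is to base 2. A *code-function* over horizon $n$ is $f^n=(f_1,\dots,f_n)$ with $f_i:\mathcal Z^{i-1}\to\mathcal X$. Given $f^n$, the law of $(X^n,Y^n,Z^n)$ is $$p(x^n,y^n,z^n\mid f^n)=\prod_{i=1}^n \mathbf 1\{x_i=f_i(z^{i-1})\}\,p(y_i\mid x^i,y^{i-1})\,p(z_i\mid y^i,z^{i-1}).$$ An $(n,M,\epsilon)$ code consists of $M\ge 1$ code-functions $f^n[1],\dots,f^n[M]$ and a decoder $g:\mathcal Y^n\to\{1,\dots,M\}$ with $\frac1M\sum_{w}\Pr\{g(Y^n)\ne w\mid f^n[w]\}\le\epsilon$. A rate $R\ge0$ is $\epsilon$-achievable if for every $\delta>0$ and all sufficiently large $n$ there is an $(n,M,\epsilon)$ code with $\frac1n\log M\ge R-\delta$. The capacity $C^{noise}_{FB}$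 is the supremum of the rates that are $\epsilon$-achievable for all $0<\epsilon<1$. A *channel input distribution* $X$ is given, for each $n$, by conditional distributions $\{p^{(n)}(x_i\mid x^{i-1},z^{i-1})\}_{i=1}^n$. A family $F$ of distributions of code-functions $F^n$, one for each $n$, *induces* $X$ (is good with respect to $X$) if for all $n$, $i\le n$, $x^i$, $z^{i-1}$ $$\Pr\{F_j(z^{j-1})=x_j,\ j\le i\}=\Pr\{F_j(z^{j-1})=x_j,\ j\le i-1\}\;p^{(n)}(x_i\mid x^{i-1},z^{i-1}).$$ With all probabilities taken under the joint law of $(F^n,X^n,Y^n,Z^n)$, put $$i^R(X^n(F^n)\to Y^n)=\log\frac{\prod_{i}p(Y_i\mid X^i,Y^{i-1})}{p(Y^n)}-\log\frac{\prod_i p(Y_i\mid X^i,Y^{i-1},F^i)}{\prod_i p(Y_i\mid Y^{i-1},F^i)},$$ $$\underline I^R(X(F)\to Y)=\sup\Big\{\beta:\lim_{n\to\infty}\Pr\{\tfrac1n i^R(X^n(F^n)\to Y^n)<\beta\}=0\Big\}.$$ Then every channel input distribution $X$ is induced by some $F$, and $$C^{noise}_{FB}=\sup_X\underline I^R(X(F)\to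 Y),$$ where the supremum runs over all channel input distributions $X$ and, for each $X$, over all code-function distributions $F$ that induce $X$. -/

import Mathlib

open Filter Topology

noncomputable section

namespace NoisyFeedback

/-! Time is indexed from `0`: the `i`-th symbol (`i = 0, 1, …`) is the one written with the
index `i + 1` when counting from `1`. Probability mass functions on a finite set `A` are the points
of `stdSimplex ℝ A`. -/

/-- The first `k` symbols of a sequence of length `n`. -/
def pre {α : Type*} {n : ℕ} (x : Fin n → α) (k : ℕ) (hk : k ≤ n) : Fin k → α :=
  fun j => x (Fin.castLE hk j)

/-- The symbols strictly before time `i`. -/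
abbrev past {α : Type*} {n : ℕ} (x : Fin n → α) (i : Fin n) : Fin i → α :=
  pre x i i.isLt.le

/-- The symbols up to and including time `i`. -/
abbrev upTo {α : Type*} {n : ℕ} (x : Fin n → α) (i : Fin n) : Fin (i + 1) → α :=
  pre x (i + 1) i.isLt

/-- A channel `p(y_i | x^i, y^{i-1})`, at every time. -/
abbrev Channel (X Y : Type*) [Fintype Y] : Type _ :=
  (i : ℕ) → (Fin (i + 1) → X) → (Fin i → Y) → stdSimplex ℝ Y

/-- A feedback link `p(z_i | y^i, z^{i-1})`, at every time. -/
abbrev FeedbackLink (Y Z : Type*) [Fintype Z] : Type _ :=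
  (i : ℕ) → (Fin (i + 1) → Y) → (Fin i → Z) → stdSimplex ℝ Z

/-- A channel input distribution `p(x_i | x^{i-1}, z^{i-1})` over the time horizon `n`. -/
abbrev InputDist (X Z : Type*) [Fintype X] (n : ℕ) : Type _ :=
  (i : Fin n) → (Fin i → X) → (Fin i → Z) → stdSimplex ℝ X

/-- A code-function over the time horizon `n`: maps `f_i : z^{i-1} ↦ x_i`. -/
abbrev CodeFn (X Z : Type*) (n : ℕ) : Type _ :=
  (i : Fin n) → (Fin i → Z) → X

/-- The components of a code-function up to and including time `i`. -/
def CodeFn.upTo {X Z : Type*} {n : ℕ} (f : CodeFn X Z n) (i : Fin n) : CodeFn X Z (i + 1) :=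
  fun j => f (Fin.castLE i.isLt j)

open scoped Classical in
/-- A distribution `p(f^n)` of code-functions over the time horizon `n`. -/
abbrev CodeFnDist (X Z : Type*) [Fintype X] [Fintype Z] (n : ℕ) : Type _ :=
  stdSimplex ℝ (CodeFn X Z n)

section Induced

variable {X Z : Type*} [Fintype X] [Fintype Z] {n : ℕ}

open scoped Classical in
/-- The probability that the random code-function, fed with `z`, produces the inputs `x` at the
first `k` times. -/
def pathProb (P : CodeFnDist X Z n) (k : ℕ) (x : Fin n → X) (z : Fin n → Z) : ℝ :=
  ∑ f : CodeFn X Z n, if ∀ j : Fin n, (j : ℕ) < k → f j (past z j) = x j then P.1 f else 0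

/-- The code-function distribution `P` is good with respect to the channel input distribution `q`:
conditionally on having produced `x^{i-1}` from `z^{i-2}`, the random code-function produces `x_i`
from `z^{i-1}` with probability `q(x_i | x^{i-1}, z^{i-1})`. -/
def Induces (P : CodeFnDist X Z n) (q : InputDist X Z n) : Prop :=
  ∀ (i : Fin n) (x : Fin n → X) (z : Fin n → Z),
    pathProb P (i + 1) x z = pathProb P i x z * (q i (past x i) (past z i)).1 (x i)

end Induced

section Law

variable {X Y Z : Type*} [Fintype X] [Fintype Y] [Fintype Z]

open scoped Classical in
/-- The conditional law `p(x^n, y^n, z^n | f^n)`: inputs are produced by the code-function from the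
delayed output of the feedback link. -/
def condLaw (W : Channel X Y) (V : FeedbackLink Y Z) {n : ℕ} (f : CodeFn X Z n)
    (x : Fin n → X) (y : Fin n → Y) (z : Fin n → Z) : ℝ :=
  ∏ i : Fin n, (if x i = f i (past z i) then 1 else 0) *
    (W i (upTo x i) (past y i)).1 (y i) * (V i (upTo y i) (past z i)).1 (z i)

/-- The sample space of `(F^n, X^n, Y^n, Z^n)`. -/
abbrev Sample (X Y Z : Type*) (n : ℕ) : Type _ :=
  CodeFn X Z n × (Fin n → X) × (Fin n → Y) × (Fin n → Z)

/-- The joint law `p(f^n, x^n, y^n, z^n)` when the code-function has distribution `P`. -/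
def jointLaw (W : Channel X Y) (V : FeedbackLink Y Z) {n : ℕ} (P : CodeFnDist X Z n) :
    Sample X Y Z n → ℝ :=
  fun ω => P.1 ω.1 * condLaw W V ω.1 ω.2.1 ω.2.2.1 ω.2.2.2

end Law

section Density

open scoped Classical in
/-- The probability `p(U)` of the value that the random variable `U` takes at `ω`. -/
def probAt {Ω α : Type*} [Fintype Ω] (Q : Ω → ℝ) (U : Ω → α) (ω : Ω) : ℝ :=
  ∑ ω' : Ω, if U ω' = U ω then Q ω' else 0

/-- The conditional probability `p(U | T)` of the values that `U` and `T` take at `ω`. -/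
def condProbAt {Ω α β : Type*} [Fintype Ω] (Q : Ω → ℝ) (U : Ω → α) (T : Ω → β) (ω : Ω) : ℝ :=
  probAt Q (fun ω' => (U ω', T ω')) ω / probAt Q T ω

variable {X Y Z : Type*} [Fintype X] [Fintype Y] [Fintype Z] {n : ℕ}

open scoped Classical in
/-- The directed information density
`i(X^n → Y^n) = log (∏ p(Y_i | X^i, Y^{i-1}) / p(Y^n))`. -/
def directedDensity (Q : Sample X Y Z n → ℝ) (ω : Sample X Y Z n) : ℝ :=
  Real.logb 2 ((∏ i : Fin n, condProbAt Q (fun ω' => ω'.2.2.1 i)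
      (fun ω' => (upTo ω'.2.1 i, past ω'.2.2.1 i)) ω) /
    probAt Q (fun ω' => ω'.2.2.1) ω)

open scoped Classical in
/-- The density of the directed information causally conditioned on the code-function,
`i(X^n → Y^n || F^n) = log (∏ p(Y_i | X^i, Y^{i-1}, F^i) / ∏ p(Y_i | Y^{i-1}, F^i))`. -/
def causalDensity (Q : Sample X Y Z n → ℝ) (ω : Sample X Y Z n) : ℝ :=
  Real.logb 2 ((∏ i : Fin n, condProbAt Q (fun ω' => ω'.2.2.1 i)
      (fun ω' => (upTo ω'.2.1 i, past ω'.2.2.1 i, ω'.1.upTo i)) ω) /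
    ∏ i : Fin n, condProbAt Q (fun ω' => ω'.2.2.1 i)
      (fun ω' => (past ω'.2.2.1 i, ω'.1.upTo i)) ω)

/-- The residual directed information density
`i^R(X^n(F^n) → Y^n) = i(X^n → Y^n) - i(X^n → Y^n || F^n)`. -/
def residualDensity (Q : Sample X Y Z n → ℝ) (ω : Sample X Y Z n) : ℝ :=
  directedDensity Q ω - causalDensity Q ω

end Density

section Limit

open scoped Classical in
/-- The limit inferior in probability of random variables `A n`, where `A n` lives on the finite
probability space `Ω n` with mass function `Q n`:
the supremum of the `β` with `Prob {A n < β} → 0`. -/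
def pLiminf {Ω : ℕ → Type*} [∀ n, Fintype (Ω n)] (Q A : (n : ℕ) → Ω n → ℝ) : EReal :=
  sSup {b : EReal | ∃ β : ℝ, b = (β : EReal) ∧
    Tendsto (fun n => ∑ ω : Ω n, if A n ω < β then Q n ω else 0) atTop (𝓝 0)}

variable {X Y Z : Type*} [Fintype X] [Fintype Y] [Fintype Z]

open scoped Classical in
/-- The limit inferior in probability of `(1/n) i^R(X^n(F^n) → Y^n)` when, for each `n`, the
code-function `F^n` has distribution `P n`. -/
def residualInfRate (W : Channel X Y) (V : FeedbackLink Y Z)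
    (P : (n : ℕ) → CodeFnDist X Z n) : EReal :=
  pLiminf (fun n => jointLaw W V (P n))
    (fun n ω => (1 / (n : ℝ)) * residualDensity (jointLaw W V (P n)) ω)

end Limit

section Capacity

variable {X Y Z : Type*} [Fintype X] [Fintype Y] [Fintype Z]

open scoped Classical in
/-- The average probability of error of the code with code-functions `enc` and decoder `dec`. -/
def errorProb (W : Channel X Y) (V : FeedbackLink Y Z) {n M : ℕ}
    (enc : Fin M → CodeFn X Z n) (dec : (Fin n → Y) → Fin M) : ℝ :=
  (1 / (M : ℝ)) * ∑ w : Fin M, ∑ x : Fin n → X, ∑ y : Fin n → Y, ∑ z : Fin n → Z,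
    if dec y ≠ w then condLaw W V (enc w) x y z else 0

/-- There is an `(n, M, ε)` channel code. -/
def HasCode (W : Channel X Y) (V : FeedbackLink Y Z) (n M : ℕ) (ε : ℝ) : Prop :=
  0 < M ∧ ∃ (enc : Fin M → CodeFn X Z n) (dec : (Fin n → Y) → Fin M), errorProb W V enc dec ≤ ε

/-- `R` is `ε`-achievable: for every `δ > 0` and all sufficiently large `n` there is an
`(n, M, ε)` code with rate at least `R - δ`. -/
def IsAchievable (W : Channel X Y) (V : FeedbackLink Y Z) (ε R : ℝ) : Prop :=
  0 ≤ R ∧ ∀ δ : ℝ, 0 < δ → ∀ᶠ n : ℕ in atTop, ∃ M : ℕ,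
    HasCode W V n M ε ∧ R - δ ≤ Real.logb 2 M / n

/-- The noisy feedback capacity: the largest rate that is `ε`-achievable for all `0 < ε < 1`. -/
def capacity (W : Channel X Y) (V : FeedbackLink Y Z) : EReal :=
  sSup {r : EReal | ∃ R : ℝ, r = (R : EReal) ∧
    ∀ ε : ℝ, 0 < ε → ε < 1 → IsAchievable W V ε R}

end Capacity

end NoisyFeedback

end

noncomputable section

namespace NoisyFeedback

/-! ### Causality of the conditional law and of its prefixes -/

section Marginal

open scoped Classical

variable {X Y Z : Type*}

/-! Once a whole code-function is treated as a single input letter, noisy feedback disappears: what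
remains is an ordinary one-shot channel `outLaw` from `f` to `y`, and the theorem is the Verdú–Han
capacity formula for it.

The bridge is `residualDensity_eq`. Given `X^i` and `Y^{i-1}`, the symbol `Y_i` has law `W` whether
or not the code-function is known, so the numerators of the two densities cancel. By causality
(`expect_take`) the first `k` outputs depend only on the first `k` components of `f`, so the product
of the `p(y_i | y^{i-1}, f^i)` telescopes to `p(y^n | f^n)`. Hence `i^R` is `log (p(y | f) / p(y))`,
and its lower tail is `lowRatioProb`.

The direct part is Feinstein's lemma (`exists_code`). The converse is the Verdú–Han bound
(`lowRatioProb_codewordDist_le`), applied to the uniform distribution on a nearly optimal code for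
each `n`.

The supremum over pairs `(X, F)` is really over all `F`, since every code-function distribution
induces some input distribution (`exists_inputDist`). Conversely, each input distribution is induced
by drawing the values `f_i(z^{i-1})` independently over `z^{i-1}`, given the earlier components
(`exists_codeFnDist`). -/

theorem pre_snoc {α : Type*} {n : ℕ} (x : Fin n → α) (a : α) (k : ℕ) (hk : k ≤ n) :
    pre (Fin.snoc (α := fun _ => α) x a : Fin (n + 1) → α) k (hk.trans n.le_succ) =
      pre x k hk := by
  funext j
  have : Fin.castLE (hk.trans n.le_succ) j = (Fin.castLE hk j).castSucc := rfl
  simp only [pre, this, Fin.snoc_castSucc]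

theorem pre_self {α : Type*} {n : ℕ} (x : Fin n → α) (h : n ≤ n) : pre x n h = x := rfl

/-- The first `k` components of a code-function. -/
def CodeFn.take {n : ℕ} (f : CodeFn X Z n) (k : ℕ) (hk : k ≤ n) : CodeFn X Z k :=
  fun j => f (Fin.castLE hk j)

theorem sum_snoc {α : Type*} [Fintype α] {n : ℕ} (g : (Fin (n + 1) → α) → ℝ) :
    ∑ x, g x = ∑ x : Fin n → α, ∑ a : α, g (Fin.snoc (α := fun _ => α) x a) := by
  rw [← (Fin.snocEquiv (fun _ : Fin (n + 1) => α)).sum_comp, Fintype.sum_prod_type_right]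
  rfl

variable [Fintype Y] [Fintype Z] (W : Channel X Y) (V : FeedbackLink Y Z)

theorem condLaw_nonneg {n : ℕ} (f : CodeFn X Z n) (x : Fin n → X) (y : Fin n → Y)
    (z : Fin n → Z) : 0 ≤ condLaw W V f x y z := by
  refine Finset.prod_nonneg fun i _ => ?_
  refine mul_nonneg (mul_nonneg ?_ ((W i _ _).2.1 _)) ((V i _ _).2.1 _)
  split_ifs <;> norm_num

theorem condLaw_snoc {n : ℕ} (f : CodeFn X Z (n + 1)) (x : Fin n → X) (y : Fin n → Y)
    (z : Fin n → Z) (a : X) (b : Y) (c : Z) :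
    condLaw W V f (Fin.snoc (α := fun _ => X) x a) (Fin.snoc (α := fun _ => Y) y b)
      (Fin.snoc (α := fun _ => Z) z c) =
    condLaw W V (f.take n n.le_succ) x y z *
      ((if a = f (Fin.last n) z then 1 else 0) *
        (W n (Fin.snoc (α := fun _ => X) x a) y).1 b *
        (V n (Fin.snoc (α := fun _ => Y) y b) z).1 c) := by
  unfold condLaw
  rw [Fin.prod_univ_castSucc]
  congr 1
  · refine Finset.prod_congr rfl fun i _ => ?_
    have hx : upTo (Fin.snoc (α := fun _ => X) x a : Fin (n + 1) → X) i.castSucc = upTo x i :=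
      pre_snoc x a _ i.isLt
    have hy : upTo (Fin.snoc (α := fun _ => Y) y b : Fin (n + 1) → Y) i.castSucc = upTo y i :=
      pre_snoc y b _ i.isLt
    have hy' : past (Fin.snoc (α := fun _ => Y) y b : Fin (n + 1) → Y) i.castSucc = past y i :=
      pre_snoc y b _ i.isLt.le
    have hz' : past (Fin.snoc (α := fun _ => Z) z c : Fin (n + 1) → Z) i.castSucc = past z i :=
      pre_snoc z c _ i.isLt.le
    rw [hx, hy, hy', hz', Fin.snoc_castSucc, Fin.snoc_castSucc, Fin.snoc_castSucc]
    rfl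
  · have hy' : past (Fin.snoc (α := fun _ => Y) y b : Fin (n + 1) → Y) (Fin.last n) = y :=
      pre_snoc y b n le_rfl
    have hz' : past (Fin.snoc (α := fun _ => Z) z c : Fin (n + 1) → Z) (Fin.last n) = z :=
      pre_snoc z c n le_rfl
    rw [hy', hz', Fin.snoc_last, Fin.snoc_last, Fin.snoc_last]
    rfl

variable [Fintype X]

/-- The conditional expectation of `g(X^n, Y^n, Z^n)` given the code-function. -/
def expect {n : ℕ} (f : CodeFn X Z n)
    (g : (Fin n → X) → (Fin n → Y) → (Fin n → Z) → ℝ) : ℝ :=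
  ∑ x, ∑ y, ∑ z, condLaw W V f x y z * g x y z

/-- The indicator forces the last input to be `f (Fin.last n) z`, so its sum collapses. Peeling off
the last step this way lets the kernels `V` and `W` be summed out from the end. -/
theorem expect_succ {n : ℕ} (f : CodeFn X Z (n + 1))
    (g : (Fin (n + 1) → X) → (Fin (n + 1) → Y) → (Fin (n + 1) → Z) → ℝ) :
    expect W V f g = expect W V (f.take n n.le_succ) fun x y z =>
      ∑ b, (W n (Fin.snoc (α := fun _ => X) x (f (Fin.last n) z)) y).1 b *
        ∑ c, (V n (Fin.snoc (α := fun _ => Y) y b) z).1 c *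
          g (Fin.snoc (α := fun _ => X) x (f (Fin.last n) z)) (Fin.snoc (α := fun _ => Y) y b)
            (Fin.snoc (α := fun _ => Z) z c) := by
  unfold expect
  rw [sum_snoc]
  refine Finset.sum_congr rfl fun x _ => ?_
  simp_rw [sum_snoc (α := Y), sum_snoc (α := Z), condLaw_snoc]
  rw [Finset.sum_comm]
  refine Finset.sum_congr rfl fun y _ => ?_
  refine ((Finset.sum_congr rfl fun a _ => Finset.sum_comm).trans Finset.sum_comm).trans ?_
  refine Finset.sum_congr rfl fun z _ => ?_
  rw [Finset.sum_eq_single (f (Fin.last n) z)]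
  · rw [Finset.mul_sum]
    refine Finset.sum_congr rfl fun b _ => ?_
    rw [Finset.mul_sum, Finset.mul_sum]
    refine Finset.sum_congr rfl fun c _ => ?_
    rw [if_pos rfl]
    ring
  · intro a _ ha
    simp [ha]
  · simp

theorem expect_congr {n : ℕ} {f : CodeFn X Z n}
    {g g' : (Fin n → X) → (Fin n → Y) → (Fin n → Z) → ℝ} (h : ∀ x y z, g x y z = g' x y z) :
    expect W V f g = expect W V f g' := by
  have : g = g' := by funext x y z; exact h x y z
  rw [this]

/-- The law of the first `k` symbols depends on the first `k` components of the code-function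
only. -/
theorem expect_take {k n : ℕ} (hk : k ≤ n) (f : CodeFn X Z n)
    (g : (Fin k → X) → (Fin k → Y) → (Fin k → Z) → ℝ) :
    expect W V f (fun x y z => g (pre x k hk) (pre y k hk) (pre z k hk)) =
      expect W V (f.take k hk) g := by
  induction n, hk using Nat.le_induction with
  | base => rfl
  | succ n hk ih =>
    rw [expect_succ]
    simp_rw [pre_snoc _ _ k hk, ← Finset.sum_mul, (V _ _ _).2.2, one_mul, ← Finset.sum_mul,
      (W _ _ _).2.2, one_mul]
    exact ih (f.take n n.le_succ)

/-- Given the code-function and the past, `Y_i` is drawn from the channel. -/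
theorem expect_step {n : ℕ} (f : CodeFn X Z n) (i : Fin n)
    (φ : (Fin (i + 1) → X) → (Fin i → Y) → Y → ℝ) :
    expect W V f (fun x y _ => φ (upTo x i) (past y i) (y i)) =
      expect W V f fun x y _ => ∑ b, (W i (upTo x i) (past y i)).1 b *
        φ (upTo x i) (past y i) b := by
  -- Cutting the horizon to `i + 1` makes `Y_i` the last symbol, where `expect_succ` exposes its
  -- kernel.
  have h1 := expect_take W V (k := i + 1) i.isLt f
    (fun x y _ => φ x (pre y i (Nat.le_succ _)) (y (Fin.last i)))
  have h2 := expect_take W V (k := i + 1) i.isLt f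
    (fun x y _ => ∑ b, (W i x (pre y i (Nat.le_succ _))).1 b * φ x (pre y i (Nat.le_succ _)) b)
  refine h1.trans (Eq.trans ?_ h2.symm)
  rw [expect_succ, expect_succ]
  simp_rw [pre_snoc _ _ (i : ℕ) le_rfl, pre_self, ← Finset.sum_mul, (V _ _ _).2.2, one_mul,
    ← Finset.sum_mul, (W _ _ _).2.2, one_mul, Fin.snoc_last]

end Marginal

/-! ### The residual density as an information density of the channel from code-functions to outputs
-/

section Residual

open scoped Classical

variable {X Y Z : Type*}

/-- The indicator of a proposition, with values in `ℝ`. -/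
def ind (p : Prop) : ℝ := if p then 1 else 0

@[simp] theorem ind_true : ind True = 1 := if_pos trivial

@[simp] theorem ind_false : ind False = 0 := if_neg id

theorem ind_nonneg (p : Prop) : 0 ≤ ind p := by
  unfold ind
  split_ifs <;> norm_num

/-- The output distribution of the kernel `K` with input distribution `P`. -/
def marginal {A B : Type*} [Fintype A] (P : A → ℝ) (K : A → B → ℝ) (b : B) : ℝ :=
  ∑ a, P a * K a b

theorem upTo_eq_iff {α : Type*} {n : ℕ} (x x' : Fin n → α) (i : Fin n) :
    upTo x i = upTo x' i ↔ x i = x' i ∧ past x i = past x' i := by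
  constructor
  · intro h
    exact ⟨congrFun h (Fin.last i), funext fun j => congrFun h j.castSucc⟩
  · rintro ⟨h, h'⟩
    funext j
    refine Fin.lastCases ?_ (fun j => ?_) j
    · exact h
    · exact congrFun h' j

variable [Fintype X] [Fintype Y] [Fintype Z] (W : Channel X Y) (V : FeedbackLink Y Z)

/-- The conditional law `p(y^n | f^n)` of the channel output given the code-function. -/
def outLaw {n : ℕ} (f : CodeFn X Z n) (y : Fin n → Y) : ℝ :=
  ∑ x, ∑ z, condLaw W V f x y z

theorem outLaw_nonneg {n : ℕ} (f : CodeFn X Z n) (y : Fin n → Y) : 0 ≤ outLaw W V f y :=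
  Finset.sum_nonneg fun _ _ => Finset.sum_nonneg fun _ _ => condLaw_nonneg W V _ _ _ _

theorem expect_output {n : ℕ} (f : CodeFn X Z n) (g : (Fin n → Y) → ℝ) :
    expect W V f (fun _ y _ => g y) = ∑ y, outLaw W V f y * g y := by
  unfold expect outLaw
  rw [Finset.sum_comm]
  simp_rw [Finset.sum_mul]

theorem expect_one {n : ℕ} (f : CodeFn X Z n) : expect W V f (fun _ _ _ => 1) = 1 := by
  refine (expect_take W V n.zero_le f (fun _ _ _ => 1)).trans ?_
  simp [expect, condLaw]

theorem sum_outLaw {n : ℕ} (f : CodeFn X Z n) : ∑ y, outLaw W V f y = 1 := by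
  simpa using (expect_output W V f fun _ => 1).symm.trans (expect_one W V f)

theorem outLaw_take {n : ℕ} (f : CodeFn X Z n) (k : ℕ) (hk : k ≤ n) (b : Fin k → Y) :
    expect W V f (fun _ y _ => ind (pre y k hk = b)) = outLaw W V (f.take k hk) b := by
  refine (expect_take W V hk f (fun _ y _ => ind (y = b))).trans ?_
  rw [expect_output]
  simp [ind]

theorem sum_jointLaw_mul {n : ℕ} (P : CodeFnDist X Z n) (g : Sample X Y Z n → ℝ) :
    ∑ ω, jointLaw W V P ω * g ω = ∑ f, P.1 f * expect W V f fun x y z => g (f, x, y, z) := by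
  simp_rw [Fintype.sum_prod_type, jointLaw, expect, Finset.mul_sum, mul_assoc]

theorem probAt_jointLaw {n : ℕ} (P : CodeFnDist X Z n) {τ : Type*} (U : Sample X Y Z n → τ)
    (ω : Sample X Y Z n) :
    probAt (jointLaw W V P) U ω =
      ∑ f, P.1 f * expect W V f fun x y z => ind (U (f, x, y, z) = U ω) := by
  rw [← sum_jointLaw_mul W V P fun ω' => ind (U ω' = U ω)]
  simp [probAt, ind]

theorem jointLaw_nonneg {n : ℕ} (P : CodeFnDist X Z n) (ω : Sample X Y Z n) :
    0 ≤ jointLaw W V P ω :=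
  mul_nonneg (P.2.1 _) (condLaw_nonneg W V _ _ _ _)

/-- Densities matter only at atoms of positive mass, and there no denominator vanishes; this keeps
the default values of division and `logb` out of the argument. -/
theorem probAt_ne_zero {n : ℕ} {P : CodeFnDist X Z n} {τ : Type*} (U : Sample X Y Z n → τ)
    {ω : Sample X Y Z n} (hω : jointLaw W V P ω ≠ 0) : probAt (jointLaw W V P) U ω ≠ 0 := by
  have hpos := (jointLaw_nonneg W V P ω).lt_of_ne' hω
  refine (hpos.trans_le ?_).ne'
  have := Finset.single_le_sum (s := Finset.univ)
    (f := fun ω' => if U ω' = U ω then jointLaw W V P ω' else 0)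
    (fun ω' _ => by split_ifs; exacts [jointLaw_nonneg W V P ω', le_rfl])
    (Finset.mem_univ ω)
  simpa [probAt] using this

/-- Conditioning on a function of the code-function, `X^i` and `Y^{i-1}` that determines `X^i` and
`Y^{i-1}` gives back the channel. -/
theorem condProbAt_eq_channel {n : ℕ} {P : CodeFnDist X Z n} {τ : Type*} (i : Fin n)
    (t : CodeFn X Z n → (Fin (i + 1) → X) → (Fin i → Y) → τ)
    (ht : ∀ f a b f' a' b', t f a b = t f' a' b' → a = a' ∧ b = b')
    {ω : Sample X Y Z n} (hω : jointLaw W V P ω ≠ 0) :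
    condProbAt (jointLaw W V P) (fun ω' => ω'.2.2.1 i)
      (fun ω' => t ω'.1 (upTo ω'.2.1 i) (past ω'.2.2.1 i)) ω =
    (W i (upTo ω.2.1 i) (past ω.2.2.1 i)).1 (ω.2.2.1 i) := by
  unfold condProbAt
  rw [div_eq_iff (probAt_ne_zero W V _ hω), probAt_jointLaw, probAt_jointLaw, Finset.mul_sum]
  refine Finset.sum_congr rfl fun f _ => ?_
  rw [mul_left_comm]
  congr 1
  obtain ⟨f₀, x₀, y₀, z₀⟩ := ω
  dsimp only
  rw [expect_step W V f i (fun a b c => ind ((c, t f a b) =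
    (y₀ i, t f₀ (upTo x₀ i) (past y₀ i))))]
  unfold expect
  simp_rw [Finset.mul_sum]
  refine Finset.sum_congr rfl fun x _ => Finset.sum_congr rfl fun y _ =>
    Finset.sum_congr rfl fun z _ => ?_
  rw [← Finset.mul_sum, mul_left_comm]
  congr 1
  -- If the conditioning values agree, `ht` identifies the channel row with the one at `ω`;
  -- otherwise both sides vanish.
  by_cases h : t f (upTo x i) (past y i) = t f₀ (upTo x₀ i) (past y₀ i)
  · obtain ⟨h1, h2⟩ := ht _ _ _ _ _ _ h
    simp [h, ← h1, ← h2, ind]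
  · simp [h]

theorem outLaw_take_ne_zero {n : ℕ} {P : CodeFnDist X Z n} {ω : Sample X Y Z n}
    (hω : jointLaw W V P ω ≠ 0) (k : ℕ) (hk : k ≤ n) :
    outLaw W V (ω.1.take k hk) (pre ω.2.2.1 k hk) ≠ 0 := by
  obtain ⟨f, x, y, z⟩ := ω
  have hpos : 0 < condLaw W V f x y z :=
    (condLaw_nonneg W V f x y z).lt_of_ne' (right_ne_zero_of_mul hω)
  refine (hpos.trans_le ?_).ne'
  rw [← outLaw_take W V f k hk]
  dsimp only
  have h0 : ∀ x y' z, 0 ≤ condLaw W V f x y' z * (ind (pre y' k hk = pre y k hk)) :=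
    fun x y' z => mul_nonneg (condLaw_nonneg W V f x y' z) (ind_nonneg _)
  refine le_trans ?_ (Finset.single_le_sum (fun x _ => Finset.sum_nonneg fun y _ =>
    Finset.sum_nonneg fun z _ => h0 x y z) (Finset.mem_univ x))
  refine le_trans ?_ (Finset.single_le_sum (fun y _ =>
    Finset.sum_nonneg fun z _ => h0 x y z) (Finset.mem_univ y))
  refine le_trans ?_ (Finset.single_le_sum (fun z _ => h0 x y z) (Finset.mem_univ z))
  simp

/-- `p(y_i | y^{i-1}, f^i) = p(y^i | f^i) / p(y^{i-1} | f^{i-1})`. -/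
theorem condProbAt_given_codeFn {n : ℕ} {P : CodeFnDist X Z n} (i : Fin n)
    {ω : Sample X Y Z n} (hω : jointLaw W V P ω ≠ 0) :
    condProbAt (jointLaw W V P) (fun ω' => ω'.2.2.1 i)
      (fun ω' => (past ω'.2.2.1 i, ω'.1.upTo i)) ω =
    outLaw W V (ω.1.take (i + 1) i.isLt) (pre ω.2.2.1 (i + 1) i.isLt) /
      outLaw W V (ω.1.take i i.isLt.le) (pre ω.2.2.1 i i.isLt.le) := by
  have hden := probAt_ne_zero W V (fun ω' : Sample X Y Z n =>
    (past ω'.2.2.1 i, ω'.1.upTo i)) hω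
  have hG := outLaw_take_ne_zero W V hω i i.isLt.le
  unfold condProbAt
  rw [div_eq_div_iff hden hG, probAt_jointLaw, probAt_jointLaw]
  obtain ⟨f₀, x₀, y₀, z₀⟩ := ω
  dsimp only
  rw [Finset.sum_mul, Finset.mul_sum]
  refine Finset.sum_congr rfl fun f _ => ?_
  -- Code-functions with another prefix contribute zero. Those with the prefix of `f₀` all share the
  -- same output law, so the total weight of the prefix cancels in the ratio.
  by_cases h : f.upTo i = f₀.upTo i
  · have h1 : f.take (i + 1) i.isLt = f₀.take (i + 1) i.isLt := h
    have h2 : f.take i i.isLt.le = f₀.take i i.isLt.le :=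
      congrArg (fun g : CodeFn X Z (i + 1) => g.take i (Nat.le_succ _)) h1
    have e1 : expect W V f (fun x y z => ind ((y i, past y i, f.upTo i) =
        (y₀ i, past y₀ i, f₀.upTo i))) =
        outLaw W V (f₀.take (i + 1) i.isLt) (pre y₀ (i + 1) i.isLt) := by
      rw [← h1, ← outLaw_take]
      refine expect_congr W V fun x y z => ?_
      simp only [Prod.mk.injEq, h, and_true, ← upTo_eq_iff]
    have e2 : expect W V f (fun x y z => ind ((past y i, f.upTo i) =
        (past y₀ i, f₀.upTo i))) =
        outLaw W V (f₀.take i i.isLt.le) (pre y₀ i i.isLt.le) := by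
      rw [← h2, ← outLaw_take]
      refine expect_congr W V fun x y z => ?_
      simp only [Prod.mk.injEq, h, and_true]
    rw [e1, e2]
    ring
  · simp [h, expect]

theorem prod_div_telescope {n : ℕ} (G : (k : ℕ) → k ≤ n → ℝ) (hG : ∀ k hk, G k hk ≠ 0) :
    ∏ i : Fin n, G (i + 1) i.isLt / G i i.isLt.le = G n le_rfl / G 0 n.zero_le := by
  induction n with
  | zero => simp [hG]
  | succ n ih =>
    rw [Fin.prod_univ_castSucc]
    have := ih (fun k hk => G k (hk.trans n.le_succ)) fun k hk => hG _ _
    simp only [Fin.val_castSucc, Fin.val_last]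
    rw [this, mul_comm, div_mul_div_cancel₀ (hG _ _)]

/-- The residual directed information density is the information density between the code-function
and the channel output. -/
theorem residualDensity_eq {n : ℕ} {P : CodeFnDist X Z n} {ω : Sample X Y Z n}
    (hω : jointLaw W V P ω ≠ 0) :
    residualDensity (jointLaw W V P) ω =
      Real.logb 2 (outLaw W V ω.1 ω.2.2.1 / marginal P.1 (outLaw W V) ω.2.2.1) := by
  have hA : ∏ i : Fin n, (W i (upTo ω.2.1 i) (past ω.2.2.1 i)).1 (ω.2.2.1 i) ≠ 0 := by
    refine Finset.prod_ne_zero_iff.2 fun i _ h => hω ?_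
    unfold jointLaw condLaw
    rw [Finset.prod_eq_zero (Finset.mem_univ i), mul_zero]
    rw [h, mul_zero, zero_mul]
  have hp : probAt (jointLaw W V P) (fun ω' => ω'.2.2.1) ω = marginal P.1 (outLaw W V) ω.2.2.1 := by
    rw [probAt_jointLaw]
    refine Finset.sum_congr rfl fun f _ => ?_
    congr 1
    exact outLaw_take W V f n le_rfl _
  have hp0 := probAt_ne_zero W V (fun ω' => ω'.2.2.1) hω
  rw [hp] at hp0
  have hK : outLaw W V ω.1 ω.2.2.1 ≠ 0 := outLaw_take_ne_zero W V hω n le_rfl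
  unfold residualDensity directedDensity causalDensity
  rw [hp, Finset.prod_congr rfl fun i _ => condProbAt_eq_channel W V i
      (fun _ a b => (a, b)) (by simp) hω,
    Finset.prod_congr rfl fun i _ => condProbAt_eq_channel W V i
      (fun f a b => (a, b, f.upTo i)) (by simp +contextual) hω,
    Finset.prod_congr rfl fun i _ => condProbAt_given_codeFn W V i hω,
    prod_div_telescope (fun k hk => outLaw W V (ω.1.take k hk) (pre ω.2.2.1 k hk))
      (outLaw_take_ne_zero W V hω)]
  have h0 : outLaw W V (ω.1.take 0 n.zero_le) (pre ω.2.2.1 0 n.zero_le) = 1 := by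
    simp [outLaw, condLaw]
  have hn : outLaw W V (ω.1.take n le_rfl) (pre ω.2.2.1 n le_rfl) = outLaw W V ω.1 ω.2.2.1 := rfl
  rw [h0, hn, div_one, Real.logb_div hA hp0, Real.logb_div hA hK, Real.logb_div hK hp0]
  ring

end Residual

/-! ### One-shot coding for a kernel: Feinstein's lemma and the Verdú–Han bound -/

section OneShot

open scoped Classical

variable {A B : Type*}

theorem exists_decoder [Fintype B] {K : A → B → ℝ} (hK : ∀ a b, 0 ≤ K a b)
    (hK1 : ∀ a, ∑ b, K a b = 1) {M : ℕ} (hM : 0 < M)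
    {ε : ℝ} (enc : Fin M → A) (S : Fin M → Finset B) (hS : ∀ v w, v ≠ w → Disjoint (S v) (S w))
    (he : ∀ w, 1 - ε ≤ ∑ b ∈ S w, K (enc w) b) :
    ∃ dec : B → Fin M, ∀ w, ∑ b, (if dec b ≠ w then K (enc w) b else 0) ≤ ε := by
  obtain ⟨dec, hdec⟩ : ∃ dec : B → Fin M, ∀ w, ∀ b ∈ S w, dec b = w := by
    refine ⟨fun b => if h : ∃ w, b ∈ S w then h.choose else ⟨0, hM⟩, fun w b hb => ?_⟩
    have h : ∃ w, b ∈ S w := ⟨w, hb⟩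
    dsimp only
    rw [dif_pos h]
    by_contra hne
    exact Finset.disjoint_left.1 (hS _ _ hne) h.choose_spec hb
  refine ⟨dec, fun w => ?_⟩
  have h1 := hK1 (enc w)
  rw [← Finset.sum_add_sum_compl (S w)] at h1
  rw [← Finset.sum_add_sum_compl (S w),
    Finset.sum_eq_zero fun b hb => if_neg (not_not.2 (hdec w b hb)), zero_add]
  have h3 : ∀ b ∈ (S w)ᶜ, (if dec b ≠ w then K (enc w) b else 0) ≤ K (enc w) b := fun b _ => by
    split_ifs
    exacts [le_rfl, hK _ _]
  linarith [Finset.sum_le_sum h3, he w]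

variable [Fintype A]

variable {P : A → ℝ} {K : A → B → ℝ}

theorem marginal_nonneg (hP : ∀ a, 0 ≤ P a) (hK : ∀ a b, 0 ≤ K a b) (b : B) :
    0 ≤ marginal P K b :=
  Finset.sum_nonneg fun a _ => mul_nonneg (hP a) (hK a b)

variable [Fintype B]

/-- The probability that the likelihood ratio `K(b | a) / p(b)` is less than `c`. -/
def lowRatioProb (P : A → ℝ) (K : A → B → ℝ) (c : ℝ) : ℝ :=
  ∑ a, ∑ b, if K a b < c * marginal P K b then P a * K a b else 0

theorem sum_marginal (hP1 : ∑ a, P a = 1) (hK1 : ∀ a, ∑ b, K a b = 1) :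
    ∑ b, marginal P K b = 1 := by
  unfold marginal
  rw [Finset.sum_comm]
  simp_rw [← Finset.mul_sum, hK1, mul_one, hP1]

theorem lowRatioProb_nonneg (hP : ∀ a, 0 ≤ P a) (hK : ∀ a b, 0 ≤ K a b) (c : ℝ) :
    0 ≤ lowRatioProb P K c :=
  Finset.sum_nonneg fun a _ => Finset.sum_nonneg fun b _ => by
    split_ifs
    exacts [mul_nonneg (hP a) (hK a b), le_rfl]

/-- One step of Feinstein's construction: outside a set `D` of small output probability there is
room for one more codeword. -/
theorem exists_codeword (hP : ∀ a, 0 ≤ P a) (hP1 : ∑ a, P a = 1) (hK : ∀ a b, 0 ≤ K a b)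
    (hK1 : ∀ a, ∑ b, K a b = 1) {c ε : ℝ} (hc : 0 < c) (D : Finset B)
    (hD : lowRatioProb P K c + ∑ b ∈ D, marginal P K b ≤ ε) :
    ∃ (a : A) (S : Finset B), Disjoint S D ∧ ∑ b ∈ S, marginal P K b ≤ 1 / c ∧
      1 - ε ≤ ∑ b ∈ S, K a b := by
  by_contra! h
  -- The outputs outside `D` with likelihood ratio at least `c`. There `c * p(b) ≤ K a b`, so the
  -- output mass of `S a` is at most `1 / c`; only the capture probability can fail.
  let S : A → Finset B := fun a => {b | c * marginal P K b ≤ K a b ∧ b ∉ D}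
  have hS : ∀ a, ∑ b ∈ S a, K a b < 1 - ε := by
    intro a
    refine h a (S a) ?_ ?_
    · rw [Finset.disjoint_left]
      intro b hb
      simpa using (Finset.mem_filter.1 hb).2.2
    · rw [le_div_iff₀ hc, mul_comm, Finset.mul_sum]
      calc ∑ b ∈ S a, c * marginal P K b ≤ ∑ b ∈ S a, K a b :=
            Finset.sum_le_sum fun b hb => (Finset.mem_filter.1 hb).2.1
        _ ≤ ∑ b, K a b :=
            Finset.sum_le_sum_of_subset_of_nonneg (Finset.subset_univ _) fun b _ _ => hK a b
        _ = 1 := hK1 a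
  have hlt : ∑ a, P a * ∑ b ∈ S a, K a b < ∑ a, P a * (1 - ε) := by
    refine Finset.sum_lt_sum (fun a _ => mul_le_mul_of_nonneg_left (hS a).le (hP a)) ?_
    obtain ⟨a, ha, ha'⟩ := Finset.exists_ne_zero_of_sum_ne_zero (hP1.trans_ne one_ne_zero)
    exact ⟨a, ha, mul_lt_mul_of_pos_left (hS a) ((hP a).lt_of_ne' ha')⟩
  rw [← Finset.sum_mul, hP1, one_mul] at hlt
  -- Every pair `(a, b)` has low ratio, or `b ∈ D`, or `b ∈ S a`. The total mass 1 is then below `ε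
  -- + (1 - ε)`, a contradiction.
  have hcover : ∑ a, ∑ b, P a * K a b ≤ lowRatioProb P K c + ∑ b ∈ D, marginal P K b +
      ∑ a, P a * ∑ b ∈ S a, K a b := by
    have hm : ∑ b ∈ D, marginal P K b = ∑ a, ∑ b, if b ∈ D then P a * K a b else 0 := by
      have hb : ∀ b, ∑ a, (if b ∈ D then P a * K a b else 0) =
          if b ∈ D then marginal P K b else 0 := fun b => by split_ifs <;> simp [marginal]
      rw [Finset.sum_comm, Finset.sum_congr rfl fun b _ => hb b]
      simp
    rw [hm, lowRatioProb, ← Finset.sum_add_distrib, ← Finset.sum_add_distrib]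
    refine Finset.sum_le_sum fun a _ => ?_
    rw [Finset.mul_sum, Finset.sum_filter, ← Finset.sum_add_distrib, ← Finset.sum_add_distrib]
    refine Finset.sum_le_sum fun b _ => ?_
    have := mul_nonneg (hP a) (hK a b)
    by_cases h1 : K a b < c * marginal P K b
    · by_cases h2 : b ∈ D <;> simp [h1, h1.not_ge, h2, this]
    · by_cases h2 : b ∈ D <;> simp [h1, not_lt.1 h1, h2]
  simp_rw [← Finset.mul_sum, hK1, mul_one, hP1] at hcover
  linarith

/-- Feinstein's lemma. -/
theorem exists_code (hP : ∀ a, 0 ≤ P a) (hP1 : ∑ a, P a = 1) (hK : ∀ a b, 0 ≤ K a b)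
    (hK1 : ∀ a, ∑ b, K a b = 1) {c ε : ℝ} (hc : 0 < c) (M : ℕ)
    (h : lowRatioProb P K c + M / c ≤ ε) :
    ∃ (enc : Fin M → A) (S : Fin M → Finset B), (∀ v w, v ≠ w → Disjoint (S v) (S w)) ∧
      (∀ w, ∑ b ∈ S w, marginal P K b ≤ 1 / c) ∧ ∀ w, 1 - ε ≤ ∑ b ∈ S w, K (enc w) b := by
  induction M with
  | zero => exact ⟨Fin.elim0, Fin.elim0, fun v => v.elim0, fun v => v.elim0, fun v => v.elim0⟩
  | succ M ih =>
    rw [Nat.cast_succ, add_div] at h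
    have hc' : 0 < 1 / c := by positivity
    obtain ⟨enc, S, hd, hp, he⟩ := ih (by linarith)
    -- The set to avoid is the union of the `M` earlier decoding sets, of output mass at most `M /
    -- c`, which the budget `ε` covers.
    obtain ⟨a, T, hT, hTp, hTe⟩ := exists_codeword hP hP1 hK hK1 (ε := ε) hc
      (Finset.univ.biUnion S) (by
        rw [Finset.sum_biUnion fun v _ w _ => hd v w]
        have h2 : ∑ w, ∑ b ∈ S w, marginal P K b ≤ ∑ _w : Fin M, 1 / c :=
          Finset.sum_le_sum fun w _ => hp w
        simp only [Finset.sum_const, Finset.card_univ, Fintype.card_fin, nsmul_eq_mul] at h2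
        rw [mul_one_div] at h2
        linarith)
    have hT' : ∀ w, Disjoint T (S w) := fun w =>
      hT.mono_right (Finset.subset_biUnion_of_mem S (Finset.mem_univ w))
    refine ⟨Fin.snoc (α := fun _ => A) enc a, Fin.snoc (α := fun _ => Finset B) S T,
      fun v w => ?_, fun w => ?_, fun w => ?_⟩
    · refine Fin.lastCases ?_ (fun v => ?_) v <;> refine Fin.lastCases ?_ (fun w => ?_) w
      · simp
      · intro _
        simpa using hT' w
      · intro _
        simpa using (hT' v).symm
      · intro hvw
        simpa using hd v w fun e => hvw (e ▸ rfl)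
    · refine Fin.lastCases ?_ (fun w => ?_) w
      · simpa using hTp
      · simpa using hp w
    · refine Fin.lastCases ?_ (fun w => ?_) w
      · simpa using hTe
      · simpa using he w

/-- The distribution of a uniformly chosen codeword. -/
def codewordDist {M : ℕ} (enc : Fin M → A) (a : A) : ℝ :=
  1 / (M : ℝ) * ∑ w, if enc w = a then 1 else 0

theorem sum_codewordDist_mul {M : ℕ} (enc : Fin M → A) (g : A → ℝ) :
    ∑ a, codewordDist enc a * g a = 1 / (M : ℝ) * ∑ w, g (enc w) := by
  simp_rw [codewordDist, mul_assoc, Finset.sum_mul, ← Finset.mul_sum]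
  rw [Finset.sum_comm]
  simp

theorem codewordDist_mem {M : ℕ} (hM : 0 < M) (enc : Fin M → A) :
    codewordDist enc ∈ stdSimplex ℝ A := by
  refine ⟨fun a => mul_nonneg (by positivity) (Finset.sum_nonneg fun w _ => ?_), ?_⟩
  · split_ifs <;> norm_num
  · have := sum_codewordDist_mul enc fun _ => 1
    have hM' : (M : ℝ) ≠ 0 := by positivity
    simpa [hM'] using this

/-- The Verdú–Han lower bound on the error probability of a code. -/
theorem lowRatioProb_codewordDist_le (hK : ∀ a b, 0 ≤ K a b) (hK1 : ∀ a, ∑ b, K a b = 1) {M : ℕ}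
    (hM : 0 < M) (enc : Fin M → A) (dec : B → Fin M) {c : ℝ} (hc : 0 ≤ c) :
    lowRatioProb (codewordDist enc) K c ≤
      1 / (M : ℝ) * (∑ w, ∑ b, if dec b ≠ w then K (enc w) b else 0) + c / M := by
  have hmem := codewordDist_mem hM enc
  have hp := marginal_nonneg hmem.1 hK
  have h1 : lowRatioProb (codewordDist enc) K c = ∑ a, codewordDist enc a *
      ∑ b, if K a b < c * marginal (codewordDist enc) K b then K a b else 0 := by
    simp_rw [lowRatioProb, Finset.mul_sum, mul_ite, mul_zero]
  -- The decoding regions partition the outputs. A low-ratio pair is either decoded wrongly and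
  -- charged to the error, or decoded correctly and bounded by `c * p(b)`; the latter bounds add up
  -- to `c` over all messages.
  have h2 : ∑ w : Fin M, ∑ b, (if dec b = w then c * marginal (codewordDist enc) K b else 0) = c := by
    rw [Finset.sum_comm]
    simp [← Finset.mul_sum, sum_marginal hmem.2 hK1]
  have hcM : c / M = 1 / (M : ℝ) * c := by ring
  rw [h1, sum_codewordDist_mul, hcM, ← mul_add]
  refine mul_le_mul_of_nonneg_left ?_ (by positivity)
  conv_rhs => rw [← h2]
  rw [← Finset.sum_add_distrib]
  refine Finset.sum_le_sum fun w _ => ?_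
  rw [← Finset.sum_add_distrib]
  refine Finset.sum_le_sum fun b _ => ?_
  have hcp := mul_nonneg hc (hp b)
  by_cases h3 : dec b = w
  · simp only [h3, ne_eq, not_true_eq_false, if_false, if_true, zero_add]
    split_ifs with h4
    exacts [h4.le, hcp]
  · simp only [h3, ne_eq, not_false_eq_true, if_false, if_true, add_zero]
    split_ifs with h4
    exacts [le_rfl, hK _ _]

end OneShot

/-! ### Code-function distributions and the input distributions they induce -/

section Inducing

open scoped Classical

variable {X Z : Type*}

/-- The code-function that continues `f` with the component `h`. -/
def CodeFn.extend {n : ℕ} (f : CodeFn X Z n) (h : (Fin n → Z) → X) : CodeFn X Z (n + 1) :=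
  Fin.snoc (α := fun i : Fin (n + 1) => (Fin i → Z) → X) f h

theorem CodeFn.extend_castSucc {n : ℕ} (f : CodeFn X Z n) (h : (Fin n → Z) → X) (i : Fin n) :
    f.extend h i.castSucc = f i :=
  Fin.snoc_castSucc (α := fun i : Fin (n + 1) => (Fin i → Z) → X) h f i

theorem CodeFn.extend_last {n : ℕ} (f : CodeFn X Z n) (h : (Fin n → Z) → X) :
    f.extend h (Fin.last n) = h :=
  Fin.snoc_last (α := fun i : Fin (n + 1) => (Fin i → Z) → X) h f

variable [Fintype X] [Fintype Z]

theorem pathProb_congr {n : ℕ} (P : CodeFnDist X Z n) {k : ℕ} {x x' : Fin n → X}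
    {z z' : Fin n → Z} (hx : ∀ j : Fin n, (j : ℕ) < k → x j = x' j)
    (hz : ∀ j : Fin n, (j : ℕ) < k → past z j = past z' j) :
    pathProb P k x z = pathProb P k x' z' := by
  refine Finset.sum_congr rfl fun f _ => ?_
  refine if_congr (forall₂_congr fun j hj => ?_) rfl rfl
  rw [hx j hj, hz j hj]

theorem pathProb_nonneg {n : ℕ} (P : CodeFnDist X Z n) (k : ℕ) (x : Fin n → X) (z : Fin n → Z) :
    0 ≤ pathProb P k x z :=
  Finset.sum_nonneg fun f _ => by
    split_ifs
    exacts [P.2.1 f, le_rfl]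

theorem sum_pathProb_succ {n : ℕ} (P : CodeFnDist X Z n) (i : Fin n) (x : Fin n → X)
    (z : Fin n → Z) :
    ∑ u, pathProb P (i + 1) (Function.update x i u) z = pathProb P i x z := by
  unfold pathProb
  rw [Finset.sum_comm]
  refine Finset.sum_congr rfl fun f _ => ?_
  have key : ∀ u, (∀ j : Fin n, (j : ℕ) < i + 1 → f j (past z j) = Function.update x i u j) ↔
      (∀ j : Fin n, (j : ℕ) < i → f j (past z j) = x j) ∧ f i (past z i) = u := by
    intro u
    constructor
    · intro h
      refine ⟨fun j hj => ?_, ?_⟩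
      · have hne : j ≠ i := fun e => by simp [e] at hj
        simpa [hne] using h j (by omega)
      · simpa using h i (by omega)
    · rintro ⟨h, hu⟩ j hj
      by_cases hji : j = i
      · subst hji
        simpa using hu
      · have : (j : ℕ) ≠ i := fun e => hji (Fin.ext e)
        simpa [hji] using h j (by omega)
  simp_rw [key, ite_and]
  by_cases h : ∀ j : Fin n, (j : ℕ) < i → f j (past z j) = x j
  · simp only [if_pos h, Finset.sum_ite_eq, Finset.mem_univ, if_true]
  · simp only [if_neg h, Finset.sum_const_zero]

/-- Every distribution of code-functions induces a channel input distribution. -/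
theorem exists_inputDist [Nonempty X] {n : ℕ} (P : CodeFnDist X Z n) :
    ∃ q : InputDist X Z n, Induces P q := by
  have key : ∀ (i : Fin n) (a : Fin i → X) (b : Fin i → Z), ∃ s : stdSimplex ℝ X,
      ∀ (x : Fin n → X) (z : Fin n → Z), past x i = a → past z i = b →
        pathProb P (i + 1) x z = pathProb P i x z * s.1 (x i) := by
    intro i a b
    -- On a history of positive probability the conditional law is forced to be the ratio of path
    -- probabilities, whichever extension `x₀`, `z₀` represents it. On a null history any law works,
    -- and a point mass is taken.
    by_cases h : ∃ (x : Fin n → X) (z : Fin n → Z), past x i = a ∧ past z i = b ∧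
        pathProb P i x z ≠ 0
    · obtain ⟨x₀, z₀, rfl, rfl, h0⟩ := h
      refine ⟨⟨fun u => pathProb P (i + 1) (Function.update x₀ i u) z₀ / pathProb P i x₀ z₀,
        fun u => div_nonneg (pathProb_nonneg ..) (pathProb_nonneg ..), ?_⟩, ?_⟩
      · rw [← Finset.sum_div, sum_pathProb_succ, div_self h0]
      · intro x z hx hz
        have hx' : ∀ j : Fin n, (j : ℕ) < i → x j = x₀ j := fun j hj => congrFun hx ⟨j, hj⟩
        -- Even the component at time `i` reads only `z` strictly before `i`, so agreement of `past
        -- z i` suffices up to `i + 1`.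
        have hz' : ∀ j : Fin n, (j : ℕ) < i + 1 → past z j = past z₀ j := fun j hj =>
          funext fun l => congrFun hz ⟨l, by have := l.2; omega⟩
        have e1 : pathProb P i x z = pathProb P i x₀ z₀ :=
          pathProb_congr P hx' fun j hj => hz' j (by omega)
        have e2 : pathProb P (i + 1) x z =
            pathProb P (i + 1) (Function.update x₀ i (x i)) z₀ := by
          refine pathProb_congr P (fun j hj => ?_) hz'
          by_cases hji : j = i
          · subst hji
            simp
          · have : (j : ℕ) ≠ i := fun e => hji (Fin.ext e)
            simpa [hji] using hx' j (by omega)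
        rw [e1, e2, mul_div_cancel₀ _ h0]
    · push Not at h
      obtain ⟨u⟩ := ‹Nonempty X›
      refine ⟨⟨_, single_mem_stdSimplex ℝ u⟩, fun x z hx hz => ?_⟩
      have h0 := h x z hx hz
      rw [h0, zero_mul]
      refine le_antisymm ?_ (pathProb_nonneg ..)
      rw [← h0, ← sum_pathProb_succ P i x z]
      refine le_trans ?_ (Finset.single_le_sum (fun u _ => pathProb_nonneg P (i + 1) _ z)
        (Finset.mem_univ (x i)))
      simp
  choose q hq using key
  exact ⟨q, fun i x z => hq i _ _ x z rfl rfl⟩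

theorem sum_codeFn_succ {n : ℕ} (g : CodeFn X Z (n + 1) → ℝ) :
    ∑ f, g f = ∑ f : CodeFn X Z n, ∑ h : (Fin n → Z) → X, g (f.extend h) := by
  rw [← (Fin.snocEquiv (fun i : Fin (n + 1) => (Fin i → Z) → X)).sum_comp]
  exact Fintype.sum_prod_type_right _

theorem sum_prod_stdSimplex {ι : Type*} [Fintype ι] [DecidableEq ι] (p : ι → stdSimplex ℝ X) :
    ∑ h : ι → X, ∏ b, (p b).1 (h b) = 1 := by
  have := Finset.prod_univ_sum (fun _ : ι => (Finset.univ : Finset X)) fun b u => (p b).1 u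
  rw [Fintype.piFinset_univ] at this
  rw [← this]
  exact Finset.prod_eq_one fun b _ => (p b).2.2

/-- Inserting the indicator into the factor at `b₀` turns the sum of products into a product of
sums, in which every other factor is 1. -/
theorem sum_prod_stdSimplex_apply {ι : Type*} [Fintype ι] [DecidableEq ι]
    (p : ι → stdSimplex ℝ X) (b₀ : ι) (u : X) :
    ∑ h : ι → X, (if h b₀ = u then ∏ b, (p b).1 (h b) else 0) = (p b₀).1 u := by
  have := Finset.prod_univ_sum (fun _ : ι => (Finset.univ : Finset X)) fun b v =>
    (p b).1 v * if b = b₀ → v = u then 1 else 0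
  rw [Fintype.piFinset_univ, Finset.prod_eq_single b₀] at this
  · simp only [forall_const, mul_ite, mul_one, mul_zero, Finset.sum_ite_eq', Finset.mem_univ,
      if_true] at this
    rw [this]
    refine Finset.sum_congr rfl fun h _ => ?_
    by_cases hu : h b₀ = u
    · rw [if_pos hu]
      refine Finset.prod_congr rfl fun b _ => ?_
      rw [if_pos (fun e => e ▸ hu)]
    · rw [if_neg hu, Finset.prod_eq_zero (Finset.mem_univ b₀)]
      simp [hu]
  · intro b _ hb
    simpa [hb] using (p b).2.2
  · simp

/-- Every channel input distribution is induced by a distribution of code-functions. -/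
theorem exists_codeFnDist {n : ℕ} (q : InputDist X Z n) :
    ∃ P : CodeFnDist X Z n, Induces P q := by
  induction n with
  | zero =>
    refine ⟨⟨fun _ => 1, fun _ => zero_le_one, ?_⟩, fun i => i.elim0⟩
    simp
  | succ n ih =>
    obtain ⟨P, hP⟩ := ih fun i => q i.castSucc
    -- The law of the new component at feedback `b`: the past inputs fed to `q` are those that `f`
    -- itself produces along `b`. The new values are independent over `b`.
    let p : CodeFn X Z n → (Fin n → Z) → stdSimplex ℝ X := fun f b =>
      q (Fin.last n) (fun j => f j (past b j)) b
    let m : CodeFn X Z (n + 1) → ℝ := fun f =>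
      P.1 (f.take n n.le_succ) * ∏ b, (p (f.take n n.le_succ) b).1 (f (Fin.last n) b)
    have htake : ∀ (f : CodeFn X Z n) h, (f.extend h).take n n.le_succ = f := fun f h =>
      funext fun i => f.extend_castSucc h i
    have hm : ∀ f h, m (f.extend h) = P.1 f * ∏ b, (p f b).1 (h b) := fun f h => by
      simp only [m, htake, CodeFn.extend_last]
    have hm0 : ∀ f, 0 ≤ m f := fun f =>
      mul_nonneg (P.2.1 _) (Finset.prod_nonneg fun b _ => (p _ b).2.1 _)
    have hm1 : ∑ f, m f = 1 := by
      rw [sum_codeFn_succ]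
      simp_rw [hm, ← Finset.mul_sum, sum_prod_stdSimplex, mul_one]
      exact P.2.2
    refine ⟨⟨m, hm0, hm1⟩, ?_⟩
    have hcast : ∀ (f : CodeFn X Z n) h (x : Fin (n + 1) → X) (z : Fin (n + 1) → Z) (k : ℕ),
        (∀ j : Fin (n + 1), (j : ℕ) < k → f.extend h j (past z j) = x j) ↔
        (∀ j : Fin n, (j : ℕ) < k → f j (past (pre z n n.le_succ) j) = pre x n n.le_succ j) ∧
          (n < k → h (past z (Fin.last n)) = x (Fin.last n)) := by
      intro f h x z k
      rw [Fin.forall_fin_succ']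
      refine and_congr (forall₂_congr fun j _ => ?_) ?_
      · rw [CodeFn.extend_castSucc]
        rfl
      · rw [CodeFn.extend_last]
        rfl
    have hlow : ∀ (k : ℕ) (_ : k ≤ n) (x : Fin (n + 1) → X) (z : Fin (n + 1) → Z),
        pathProb (⟨m, hm0, hm1⟩ : CodeFnDist X Z (n + 1)) k x z =
          pathProb P k (pre x n n.le_succ) (pre z n n.le_succ) := by
      intro k hk x z
      unfold pathProb
      rw [sum_codeFn_succ]
      refine Finset.sum_congr rfl fun f _ => ?_
      simp_rw [hcast, hm, hk.not_gt, false_imp_iff, and_true]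
      by_cases hc : ∀ j : Fin n, (j : ℕ) < k →
          f j (past (pre z n n.le_succ) j) = pre x n n.le_succ j
      · simp_rw [if_pos hc, ← Finset.mul_sum, sum_prod_stdSimplex, mul_one]
      · simp_rw [if_neg hc, Finset.sum_const_zero]
    have hlast : ∀ (x : Fin (n + 1) → X) (z : Fin (n + 1) → Z),
        pathProb (⟨m, hm0, hm1⟩ : CodeFnDist X Z (n + 1)) (n + 1) x z =
          pathProb P n (pre x n n.le_succ) (pre z n n.le_succ) *
            (q (Fin.last n) (past x (Fin.last n)) (past z (Fin.last n))).1 (x (Fin.last n)) := by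
      intro x z
      unfold pathProb
      rw [sum_codeFn_succ, Finset.sum_mul]
      refine Finset.sum_congr rfl fun f _ => ?_
      simp_rw [hcast, hm, ite_and]
      have hiff : (∀ j : Fin n, (j : ℕ) < n + 1 →
          f j (past (pre z n n.le_succ) j) = pre x n n.le_succ j) ↔
          ∀ j : Fin n, (j : ℕ) < n →
            f j (past (pre z n n.le_succ) j) = pre x n n.le_succ j :=
        ⟨fun h j _ => h j (by omega), fun h j _ => h j j.2⟩
      simp_rw [hiff]
      by_cases hc : ∀ j : Fin n, (j : ℕ) < n →
          f j (past (pre z n n.le_succ) j) = pre x n n.le_succ j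
      -- On the event that `f` has produced `x` along `z`, the history generated by `f` is the past
      -- of `x`, so the new value has the prescribed law.
      · have hpx : p f (past z (Fin.last n)) =
            q (Fin.last n) (past x (Fin.last n)) (past z (Fin.last n)) :=
          congrArg (fun a => q (Fin.last n) a (past z (Fin.last n))) (funext fun j => hc j j.2)
        have := sum_prod_stdSimplex_apply (p f) (past z (Fin.last n)) (x (Fin.last n))
        rw [hpx] at this
        simp_rw [if_pos hc, Nat.lt_succ_self, true_imp_iff]
        rw [← this, Finset.mul_sum]
        simp_rw [mul_ite, mul_zero]
      · simp_rw [if_neg hc, Finset.sum_const_zero, zero_mul]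
    intro i x z
    refine Fin.lastCases ?_ (fun i => ?_) i
    · exact (hlast x z).trans (congrArg (· * _) (hlow n le_rfl x z).symm)
    · exact (hlow _ i.2 x z).trans
        ((hP i _ _).trans (congrArg (· * _) (hlow _ i.2.le x z).symm))

end Inducing

/-! ### Asymptotics: the direct and converse parts -/

section Coding

open scoped Classical

variable {X Y Z : Type*} [Fintype X] [Fintype Y] [Fintype Z]
variable (W : Channel X Y) (V : FeedbackLink Y Z)

theorem errorProb_eq {n M : ℕ} (enc : Fin M → CodeFn X Z n) (dec : (Fin n → Y) → Fin M) :
    errorProb W V enc dec =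
      1 / (M : ℝ) * ∑ w, ∑ y, if dec y ≠ w then outLaw W V (enc w) y else 0 := by
  unfold errorProb outLaw
  congr 1
  refine Finset.sum_congr rfl fun w _ => ?_
  rw [Finset.sum_comm]
  refine Finset.sum_congr rfl fun y _ => ?_
  split_ifs <;> simp

theorem errorProb_nonneg {n M : ℕ} (enc : Fin M → CodeFn X Z n) (dec : (Fin n → Y) → Fin M) :
    0 ≤ errorProb W V enc dec := by
  rw [errorProb_eq]
  refine mul_nonneg (by positivity) (Finset.sum_nonneg fun w _ => Finset.sum_nonneg fun y _ => ?_)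
  split_ifs
  exacts [outLaw_nonneg W V _ _, le_rfl]

theorem residualDensity_lt_iff {n : ℕ} (hn : 0 < n) {P : CodeFnDist X Z n} {ω : Sample X Y Z n}
    (hω : jointLaw W V P ω ≠ 0) (β : ℝ) :
    1 / (n : ℝ) * residualDensity (jointLaw W V P) ω < β ↔
      outLaw W V ω.1 ω.2.2.1 < 2 ^ (n * β) * marginal P.1 (outLaw W V) ω.2.2.1 := by
  have hn' : (0 : ℝ) < n := by exact_mod_cast hn
  have hK : 0 < outLaw W V ω.1 ω.2.2.1 :=
    (outLaw_nonneg W V _ _).lt_of_ne' (outLaw_take_ne_zero W V hω n le_rfl)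
  have hP : 0 < P.1 ω.1 := (P.2.1 _).lt_of_ne' (left_ne_zero_of_mul hω)
  have hp : 0 < marginal P.1 (outLaw W V) ω.2.2.1 :=
    (mul_pos hP hK).trans_le (Finset.single_le_sum
      (f := fun f => P.1 f * outLaw W V f ω.2.2.1)
      (fun f _ => mul_nonneg (P.2.1 f) (outLaw_nonneg W V f _)) (Finset.mem_univ ω.1))
  rw [residualDensity_eq W V hω, one_div_mul_eq_div, div_lt_iff₀ hn', mul_comm β,
    Real.logb_lt_iff_lt_rpow one_lt_two (div_pos hK hp), div_lt_iff₀ hp]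

theorem sum_residualDensity_lt {n : ℕ} (hn : 0 < n) (P : CodeFnDist X Z n) (β : ℝ) :
    ∑ ω, (if 1 / (n : ℝ) * residualDensity (jointLaw W V P) ω < β then jointLaw W V P ω else 0) =
      lowRatioProb P.1 (outLaw W V) (2 ^ (n * β)) := by
  have h1 : ∀ ω : Sample X Y Z n,
      (if 1 / (n : ℝ) * residualDensity (jointLaw W V P) ω < β then jointLaw W V P ω else 0) =
      jointLaw W V P ω * ind (outLaw W V ω.1 ω.2.2.1 <
        2 ^ (n * β) * marginal P.1 (outLaw W V) ω.2.2.1) := by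
    intro ω
    by_cases hω : jointLaw W V P ω = 0
    · simp [hω]
    · simp only [residualDensity_lt_iff W V hn hω, ind, mul_ite, mul_one, mul_zero]
  rw [Finset.sum_congr rfl fun ω _ => h1 ω, sum_jointLaw_mul]
  refine Finset.sum_congr rfl fun f _ => ?_
  refine (congrArg (P.1 f * ·) (expect_output W V f fun y => ind (outLaw W V f y <
    2 ^ (n * β) * marginal P.1 (outLaw W V) y))).trans ?_
  simp only [ind, mul_ite, mul_one, mul_zero, Finset.mul_sum]

theorem residualInfRate_eq (P : (n : ℕ) → CodeFnDist X Z n) :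
    residualInfRate W V P = sSup {b : EReal | ∃ β : ℝ, b = (β : EReal) ∧
      Tendsto (fun n : ℕ => lowRatioProb (P n).1 (outLaw W V) (2 ^ (n * β))) atTop (𝓝 0)} := by
  unfold residualInfRate pLiminf
  congr 1
  ext b
  refine exists_congr fun β => and_congr_right fun _ => tendsto_congr' ?_
  -- At `n = 0` the factor `1 / n` is 0 by convention, so the tail identity is used for positive `n`
  -- only.
  filter_upwards [eventually_gt_atTop 0] with n hn
  exact sum_residualDensity_lt W V hn (P n) β

theorem tendsto_two_rpow_neg_mul {δ : ℝ} (hδ : 0 < δ) :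
    Tendsto (fun n : ℕ => (2 : ℝ) ^ (-(n * δ))) atTop (𝓝 0) := by
  have h : ∀ n : ℕ, (2 : ℝ) ^ (-(n * δ)) = ((2 : ℝ) ^ (-δ)) ^ n := fun n => by
    rw [← Real.rpow_mul_natCast zero_le_two]
    ring_nf
  simp_rw [h]
  exact tendsto_pow_atTop_nhds_zero_of_lt_one (by positivity)
    (Real.rpow_lt_one_of_one_lt_of_neg one_lt_two (by linarith))

theorem capacity_nonneg [Nonempty X] : 0 ≤ capacity W V := by
  refine le_sSup ⟨0, rfl, fun ε hε _ => ⟨le_rfl, fun δ hδ => Eventually.of_forall fun n =>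
    ⟨1, ⟨one_pos, fun _ _ _ => Classical.arbitrary X, fun _ => 0, ?_⟩, ?_⟩⟩⟩
  · refine le_trans (le_of_eq ?_) hε.le
    rw [errorProb_eq]
    refine mul_eq_zero_of_right _ (Finset.sum_eq_zero fun w _ => Finset.sum_eq_zero fun y _ => ?_)
    exact if_neg (not_not.2 (Subsingleton.elim _ _))
  · simpa using hδ.le

theorem hasCode_of_lowRatioProb_le {n M : ℕ} (hM : 0 < M) (P : CodeFnDist X Z n) {c ε : ℝ}
    (hc : 0 < c) (h : lowRatioProb P.1 (outLaw W V) c + M / c ≤ ε) : HasCode W V n M ε := by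
  obtain ⟨enc, S, hd, -, he⟩ :=
    exists_code P.2.1 P.2.2 (outLaw_nonneg W V) (sum_outLaw W V) hc M h
  obtain ⟨dec, hdec⟩ := exists_decoder (outLaw_nonneg W V) (sum_outLaw W V) hM enc S hd he
  refine ⟨hM, enc, dec, ?_⟩
  have hM' : (0 : ℝ) < M := by exact_mod_cast hM
  have hsum := Finset.sum_le_sum fun w (_ : w ∈ (Finset.univ : Finset (Fin M))) => hdec w
  rw [Finset.sum_const, Finset.card_univ, Fintype.card_fin, nsmul_eq_mul] at hsum
  rw [errorProb_eq, one_div_mul_eq_div, div_le_iff₀ hM', mul_comm ε]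
  exact hsum

/-- The direct part of the coding theorem. -/
theorem residualInfRate_le_capacity [Nonempty X] (P : (n : ℕ) → CodeFnDist X Z n) :
    residualInfRate W V P ≤ capacity W V := by
  rw [residualInfRate_eq]
  refine sSup_le ?_
  rintro _ ⟨β, rfl, hβ⟩
  -- Achievable rates are nonnegative by definition, so a nonpositive `β` is handled by the
  -- one-message code.
  rcases le_or_gt β 0 with hβ0 | hβ0
  · exact le_trans (by exact_mod_cast hβ0) (capacity_nonneg W V)
  refine le_sSup ⟨β, rfl, fun ε hε _ => ⟨hβ0.le, fun δ hδ => ?_⟩⟩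
  -- With `M = ⌈2^(n(β-δ))⌉` and `c = 2^(nβ)`, the quotient `M / c` is at most `2^(-nδ)` plus
  -- `2^(-nβ)`, the latter from rounding up.
  have hlim : Tendsto (fun n : ℕ => lowRatioProb (P n).1 (outLaw W V) (2 ^ (n * β)) +
      ((2 : ℝ) ^ (-(n * δ)) + (2 : ℝ) ^ (-(n * β)))) atTop (𝓝 0) := by
    simpa using hβ.add ((tendsto_two_rpow_neg_mul hδ).add (tendsto_two_rpow_neg_mul hβ0))
  filter_upwards [hlim.eventually_le_const hε, eventually_gt_atTop 0] with n hn hn0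
  have hn' : (0 : ℝ) < n := by exact_mod_cast hn0
  have hpos : (0 : ℝ) < 2 ^ (n * (β - δ)) := by positivity
  have hM : 0 < ⌈(2 : ℝ) ^ (n * (β - δ))⌉₊ := Nat.ceil_pos.2 hpos
  refine ⟨⌈(2 : ℝ) ^ (n * (β - δ))⌉₊, hasCode_of_lowRatioProb_le W V hM (P n)
    (c := 2 ^ (n * β)) (by positivity) (le_trans ?_ hn), ?_⟩
  · gcongr
    rw [div_le_iff₀ (by positivity), add_mul, ← Real.rpow_add two_pos, ← Real.rpow_add two_pos,
      neg_add_cancel, Real.rpow_zero]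
    convert (Nat.ceil_lt_add_one hpos.le).le using 3
    ring
  · rw [le_div_iff₀ hn', mul_comm, Real.le_logb_iff_rpow_le one_lt_two (by exact_mod_cast hM)]
    exact Nat.le_ceil _

/-- Achievability supplies a separate code for each `ε`, but the limit inferior needs one
distribution per `n`. A code whose error is within `η` of the infimum at the given rate serves all
`ε` at once. -/
theorem exists_codeFnDist_lowRatioProb_le [Nonempty X] {n : ℕ} (hn : 0 < n) (ρ : ℝ) {δ : ℝ}
    {η : ℝ} (hη : 0 < η) :
    ∃ P : CodeFnDist X Z n, ∀ ε : ℝ, (∃ M, HasCode W V n M ε ∧ ρ + δ ≤ Real.logb 2 M / n) →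
      lowRatioProb P.1 (outLaw W V) (2 ^ (n * ρ)) ≤ ε + η + 2 ^ (-(n * δ)) := by
  have hn' : (0 : ℝ) < n := by exact_mod_cast hn
  let S : Set ℝ := {e | ∃ M, HasCode W V n M e ∧ ρ + δ ≤ Real.logb 2 M / n}
  have hS0 : BddBelow S := ⟨0, by
    rintro e ⟨M, ⟨-, enc, dec, he⟩, -⟩
    exact (errorProb_nonneg W V enc dec).trans he⟩
  rcases S.eq_empty_or_nonempty with hS | hS
  · refine ⟨⟨_, single_mem_stdSimplex ℝ fun _ _ => Classical.arbitrary X⟩, fun ε hε => ?_⟩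
    exact absurd (show ε ∈ S from hε) (hS ▸ Set.notMem_empty ε)
  · obtain ⟨e, ⟨M, ⟨hM, enc, dec, he⟩, hrate⟩, hlt⟩ :=
      exists_lt_of_csInf_lt hS (lt_add_of_pos_right (sInf S) hη)
    have hM' : (0 : ℝ) < M := by exact_mod_cast hM
    refine ⟨⟨_, codewordDist_mem hM enc⟩, fun ε hε => ?_⟩
    have h1 := lowRatioProb_codewordDist_le (outLaw_nonneg W V) (sum_outLaw W V) hM enc dec
      (c := 2 ^ (n * ρ)) (by positivity)
    rw [← errorProb_eq] at h1
    have h2 : (2 : ℝ) ^ (n * ρ) / M ≤ 2 ^ (-(n * δ)) := by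
      rw [le_div_iff₀ hn', mul_comm, Real.le_logb_iff_rpow_le one_lt_two hM'] at hrate
      rw [div_le_iff₀ hM']
      calc (2 : ℝ) ^ (n * ρ) = 2 ^ (-(n * δ)) * 2 ^ (n * (ρ + δ)) := by
            rw [← Real.rpow_add two_pos]
            ring_nf
        _ ≤ _ := by gcongr
    have h3 : sInf S ≤ ε := csInf_le hS0 hε
    refine h1.trans ?_
    linarith

/-- The converse part of the coding theorem. -/
theorem exists_le_residualInfRate [Nonempty X] {R : ℝ}
    (hR : ∀ ε : ℝ, 0 < ε → ε < 1 → IsAchievable W V ε R) {r : ℝ} (hr : r < R) :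
    ∃ P : (n : ℕ) → CodeFnDist X Z n, (r : EReal) ≤ residualInfRate W V P := by
  -- Half of the gap is the rate loss allowed by achievability; the other half makes `c / M ≤
  -- 2^(-nδ)` vanish.
  obtain ⟨δ, hδ, hδr⟩ : ∃ δ : ℝ, 0 < δ ∧ r + δ = R - δ := ⟨(R - r) / 2, by linarith, by ring⟩
  have key : ∀ n : ℕ, ∃ P : CodeFnDist X Z n, 0 < n → ∀ ε : ℝ,
      (∃ M, HasCode W V n M ε ∧ r + δ ≤ Real.logb 2 M / n) →
      lowRatioProb P.1 (outLaw W V) (2 ^ (n * r)) ≤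
        ε + 1 / ((n : ℝ) + 1) + 2 ^ (-(n * δ)) := by
    intro n
    rcases n.eq_zero_or_pos with rfl | hn
    · exact ⟨⟨_, single_mem_stdSimplex ℝ fun _ _ => Classical.arbitrary X⟩,
        fun h => absurd h (lt_irrefl 0)⟩
    · obtain ⟨P, hP⟩ := exists_codeFnDist_lowRatioProb_le W V hn r (δ := δ)
        (η := 1 / ((n : ℝ) + 1)) (by positivity)
      exact ⟨P, fun _ => hP⟩
  choose P hP using key
  refine ⟨P, ?_⟩
  rw [residualInfRate_eq]
  refine le_sSup ⟨r, rfl, ?_⟩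
  refine tendsto_order.2 ⟨fun a ha => Eventually.of_forall fun n =>
    ha.trans_le (lowRatioProb_nonneg (P n).2.1 (outLaw_nonneg W V) _), fun a ha => ?_⟩
  have hlim : Tendsto (fun n : ℕ => 1 / ((n : ℝ) + 1) + (2 : ℝ) ^ (-(n * δ))) atTop (𝓝 0) := by
    simpa using tendsto_one_div_add_atTop_nhds_zero_nat.add (tendsto_two_rpow_neg_mul hδ)
  -- The first bound leaves `a / 2` for the vanishing terms; the second keeps `ε` below 1, as
  -- achievability requires.
  have hε : 0 < min (a / 2) (1 / 2) := by positivity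
  filter_upwards [(hR _ hε ((min_le_right _ _).trans_lt (by norm_num))).2 δ hδ,
    hlim.eventually_lt_const (half_pos ha), eventually_gt_atTop 0] with n hn hn2 hn0
  have := hP n hn0 _ (hδr ▸ hn)
  linarith [min_le_left (a / 2) (1 / 2)]

end Coding

end NoisyFeedback

end

theorem theorem4 {X Y Z : Type*} [Fintype X] [Fintype Y] [Fintype Z] [Nonempty X]
    (W : NoisyFeedback.Channel X Y) (V : NoisyFeedback.FeedbackLink Y Z) :
    (∀ q : (n : ℕ) → NoisyFeedback.InputDist X Z n,
      ∃ P : (n : ℕ) → NoisyFeedback.CodeFnDist X Z n,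
        ∀ n, NoisyFeedback.Induces (P n) (q n)) ∧
    NoisyFeedback.capacity W V =
      ⨆ (q : (n : ℕ) → NoisyFeedback.InputDist X Z n)
        (P : (n : ℕ) → NoisyFeedback.CodeFnDist X Z n)
        (_ : ∀ n, NoisyFeedback.Induces (P n) (q n)),
        NoisyFeedback.residualInfRate W V P := by
  refine ⟨fun q => ?_, le_antisymm (sSup_le ?_) ?_⟩
  · choose P hP using fun n => NoisyFeedback.exists_codeFnDist (q n)
    exact ⟨P, hP⟩
  · rintro _ ⟨R, rfl, hR⟩
    refine EReal.ge_of_forall_gt_iff_ge.1 fun r hr => ?_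
    obtain ⟨P, hP⟩ := NoisyFeedback.exists_le_residualInfRate W V hR (EReal.coe_lt_coe_iff.1 hr)
    -- Any family of code-function distributions is admissible in the supremum, through the input
    -- distribution it induces.
    choose q hq using fun n => NoisyFeedback.exists_inputDist (P n)
    exact hP.trans (le_iSup₂_of_le q P (le_iSup_of_le hq le_rfl))
  · exact iSup_le fun q => iSup₂_le fun P _ => NoisyFeedback.residualInfRate_le_capacity W V P
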